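/- Let $G=(V,E)$ be a finite simple undirected graph. A \emph{triangle-free 2-matching} of $G$ is a set $M\subseteq E$ such that every node is incident to at most two edges of $M$ and the graph $(V,M)$ contains no triangle. A \emph{trail} is a sequence of pairwise distinct consecutive edges $u_1u_2,u_2u_3,\dots,u_{k-1}u_k$ of $G$, whose nodes are not necessarily distinct (possibly $u_1=u_k$); we also write $P$ for the set of edges of a trail $P$. Given a triangle-free 2-matching $M$, a trail is \emph{alternating} for $M$ if of any two edges that follow each other in the sequence exactly one belongs to $M$, and an alternating trail $P$ is \emph{augmenting} for $M$ if $M\triangle P=(M\setminus P)\cup(P\setminus M)$ is a triangle-free 2-matching of $G$ with exactly $|M|+1$ edges. Let $\mathsf{APX}$ be a triangle-free 2-matching of $G$, and let $\mathsf{OPT}$ be a maximum-cardinality triangle-free 2-matching of $G$ which, among all maximum-cardinality triangle-free 2-matchings of $G$, maximizes $|\mathsf{OPT}\cap\mathsf{APX}|$. Then there exist at least $|\mathsf{OPT}|-|\mathsf{APX}|$ pairwise edge-disjoint augmenting trails for $\mathsf{APX}$, each contained in $\mathsf{APX}\triangle\mathsf{OPT}$. -/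

import Mathlib

open Finset
open scoped symmDiff

/-- `M` is a (simple) 2-matching of `G`: a set of edges of `G` such that every node is incident
to at most two edges of `M`. -/
def IsTwoMatching {V : Type*} [DecidableEq V] (G : SimpleGraph V) (M : Finset (Sym2 V)) : Prop :=
  (M : Set (Sym2 V)) ⊆ G.edgeSet ∧ ∀ v : V, #{e ∈ M | v ∈ e} ≤ 2

/-- `M` is a triangle-free 2-matching of `G`: a 2-matching such that the graph `(V, M)` contains
no triangle. -/
def IsTriangleFreeTwoMatching {V : Type*} [DecidableEq V] (G : SimpleGraph V)
    (M : Finset (Sym2 V)) : Prop :=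
  IsTwoMatching G M ∧ (SimpleGraph.fromEdgeSet (M : Set (Sym2 V))).CliqueFree 3

/-- `M` is a maximum-cardinality triangle-free 2-matching of `G`. -/
def IsMaximumTriangleFreeTwoMatching {V : Type*} [DecidableEq V] (G : SimpleGraph V)
    (M : Finset (Sym2 V)) : Prop :=
  IsTriangleFreeTwoMatching G M ∧ ∀ M', IsTriangleFreeTwoMatching G M' → #M' ≤ #M

/-- The walk `P` is a trail (its edges are pairwise distinct), and of any two consecutive edges of
`P` exactly one belongs to `M`. The trail may be closed; its last and first edges are then not
regarded as consecutive. -/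
def IsAlternatingTrail {V : Type*} {G : SimpleGraph V} (M : Finset (Sym2 V)) {u v : V}
    (P : G.Walk u v) : Prop :=
  P.IsTrail ∧ P.edges.IsChain (fun e f => ¬(e ∈ M ↔ f ∈ M))

/-- The trail `P` is alternating with respect to `M`, and the symmetric difference of `M` and the
set of edges of `P` is a triangle-free 2-matching with exactly one more edge than `M`. -/
def IsAugmentingTrail {V : Type*} [DecidableEq V] {G : SimpleGraph V} (M : Finset (Sym2 V))
    {u v : V} (P : G.Walk u v) : Prop :=
  IsAlternatingTrail M P ∧ IsTriangleFreeTwoMatching G (M ∆ P.edges.toFinset) ∧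
    #(M ∆ P.edges.toFinset) = #M + 1

/-! At every node, pair edges of `O \ A` with edges of `A \ O`, leaving unpaired edges on at most
one side. A set `K ⊆ A ∆ O` closed under the pairing can be exchanged in `A` or in `O` without
violating the degree bound, and no triangle survives if each triangle of `A ∪ O` contains a pair.
The maximality of `O` and of its overlap with `A` then makes every nonempty closed `K` contain more
edges of `O` than of `A`. Hence some edge of `O` in `K` is unpaired at one end; following the
pairing from there gives a closed alternating trail. Its excess is positive because it is closed and
at most one because it alternates, so it is augmenting. Removing it lowers the excess of `K` by one,
and iterating from `A ∆ O` yields the trails.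

The difficulty is a pairing that hits all triangles, since two triangles may claim the same edge at
a node. Alternating four-cycles that could be exchanged in `O` are excluded by the choice of `O`
(`not_alternating_fourCycle`). Then a conflict either leaves a free corner elsewhere
(`IsMixedCorner.isFreeCorner_of_conflict`) or comes from two triangles on a common edge, which can
be served at its two different ends. -/

/-! ### Mixed corners of triangles and their conflicts -/

/-- `R` holds and `S` does not. -/
def OnlyFirst {V : Type*} (R S : V → V → Prop) (x y : V) : Prop := R x y ∧ ¬ S x y

/-- A corner of a triangle at which an `O`-only edge `xy` meets an `A`-only edge `xz`. -/
def IsMixedCorner {V : Type*} (A O : V → V → Prop) (x y z : V) : Prop :=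
  OnlyFirst O A x y ∧ OnlyFirst A O x z ∧ (A y z ∨ O y z)

/-- A corner that shares neither of its two edges with another corner at the same node. -/
def IsFreeCorner {V : Type*} (A O : V → V → Prop) (x y z : V) : Prop :=
  IsMixedCorner A O x y z ∧ (∀ w, IsMixedCorner A O x y w → w = z) ∧
    ∀ u, IsMixedCorner A O x u z → u = y

/-- The triangle `xyz` has a free corner. -/
def HasFreeCorner {V : Type*} (A O : V → V → Prop) (x y z : V) : Prop :=
  IsFreeCorner A O x y z ∨ IsFreeCorner A O x z y ∨ IsFreeCorner A O y x z ∨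
    IsFreeCorner A O y z x ∨ IsFreeCorner A O z x y ∨ IsFreeCorner A O z y x

/-- Two adjacency relations of maximum degree two, without the three configurations that allow
to exchange two edges of one relation for two edges of the other one. -/
structure IsExchangeFree {V : Type*} (A O : V → V → Prop) : Prop where
  symm_left : ∀ x y, A x y → A y x
  symm_right : ∀ x y, O x y → O y x
  irrefl_left : ∀ x, ¬ A x x
  irrefl_right : ∀ x, ¬ O x x
  deg_left : ∀ x p q r, A x p → A x q → A x r → p = q ∨ p = r ∨ q = r
  deg_right : ∀ x p q r, O x p → O x q → O x r → p = q ∨ p = r ∨ q = r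
  path_path : ∀ p q r s, OnlyFirst O A p q → OnlyFirst O A q r → OnlyFirst O A r s →
    OnlyFirst A O r p → OnlyFirst A O p s → OnlyFirst A O s q → False
  path_left : ∀ p q r s d, OnlyFirst A O p q → OnlyFirst A O q r → OnlyFirst A O r s →
    OnlyFirst O A p r → OnlyFirst O A q s → OnlyFirst O A q d → OnlyFirst O A r d → False
  path_right : ∀ p q r s d, OnlyFirst O A p q → OnlyFirst O A q r → OnlyFirst O A r s →
    OnlyFirst A O p r → OnlyFirst A O q s → OnlyFirst A O q d → OnlyFirst A O r d → False

section Corners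

variable {V : Type*} {A O : V → V → Prop}

/-- This duality halves the later case analysis. `path_path` is self-dual because the complement of
a four-node path is again such a path; the other two configurations are exchanged. -/
theorem IsExchangeFree.swap (h : IsExchangeFree A O) : IsExchangeFree O A where
  symm_left := h.symm_right
  symm_right := h.symm_left
  irrefl_left := h.irrefl_right
  irrefl_right := h.irrefl_left
  deg_left := h.deg_right
  deg_right := h.deg_left
  path_path p q r s h1 h2 h3 h4 h5 h6 := by
    have hA := h.symm_left
    have hO := h.symm_right
    refine h.path_path r p s q ?_ ?_ ?_ ?_ ?_ ?_ <;> unfold OnlyFirst at * <;> grind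
  path_left := h.path_right
  path_right := h.path_left

theorem isMixedCorner_swap (x y z : V) (h : IsExchangeFree A O) :
    IsMixedCorner O A x z y ↔ IsMixedCorner A O x y z := by
  have hA := h.symm_left
  have hO := h.symm_right
  unfold IsMixedCorner
  grind

theorem isFreeCorner_swap (x y z : V) (h : IsExchangeFree A O) :
    IsFreeCorner O A x z y ↔ IsFreeCorner A O x y z := by
  simp only [IsFreeCorner, isMixedCorner_swap _ _ _ h]
  tauto

theorem hasFreeCorner_swap (x y z : V) (h : IsExchangeFree A O) :
    HasFreeCorner O A x z y ↔ HasFreeCorner A O x y z := by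
  simp only [HasFreeCorner, isFreeCorner_swap _ _ _ h]
  tauto

theorem hasFreeCorner_comm_left (x y z : V) :
    HasFreeCorner A O x y z ↔ HasFreeCorner A O y x z := by
  simp only [HasFreeCorner]
  tauto

/-- The degree bounds force `yw` to be `A`-only. A rival for the `O`-edge `yx` would create the
configuration `path_right`, and a rival for the `A`-edge `yw` would have to be `z` and create
`path_path`. -/
theorem IsMixedCorner.isFreeCorner_of_conflict (h : IsExchangeFree A O) {x y z w : V}
    (hz : IsMixedCorner A O x y z) (hw : IsMixedCorner A O x y w) (hne : z ≠ w) (hO : O y z) :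
    IsFreeCorner A O y x w := by
  obtain ⟨⟨hxy, hxy'⟩, ⟨hxz, hxz'⟩, -⟩ := hz
  obtain ⟨-, ⟨hxw, hxw'⟩, hyw⟩ := hw
  have sA := h.symm_left
  have sO := h.symm_right
  have hOyw : ¬ O y w := fun hh => by
    rcases h.deg_right y x z w (sO _ _ hxy) hO hh with e | e | e
    · subst e; exact h.irrefl_left _ hxz
    · subst e; exact h.irrefl_left _ hxw
    · exact hne e
  have hAyw : A y w := hyw.resolve_right hOyw
  refine ⟨⟨⟨sO _ _ hxy, fun hh => hxy' (sA _ _ hh)⟩, ⟨hAyw, hOyw⟩, Or.inl hxw⟩, ?_, ?_⟩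
  · rintro p ⟨-, ⟨hyp, hyp'⟩, hxp⟩
    by_contra hpw
    have hpz : p ≠ z := fun e => hyp' (e ▸ hO)
    have hAxp : ¬ A x p := fun hh => by
      have := h.deg_left x z w p hxz hxw hh
      grind
    have hAyz : ¬ A y z := fun hh => by
      have := h.deg_left y z w p hh hAyw hyp
      grind
    refine h.path_right z y x p w ⟨sO _ _ hO, ?_⟩ ⟨sO _ _ hxy, ?_⟩
      ⟨hxp.resolve_left hAxp, hAxp⟩ ⟨sA _ _ hxz, ?_⟩ ⟨hyp, hyp'⟩ ⟨hAyw, hOyw⟩ ⟨hxw, hxw'⟩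
    all_goals grind
  · rintro q ⟨⟨hyq, hyq'⟩, -, hqw⟩
    by_contra hqx
    have hxz_ne : x ≠ z := fun e => h.irrefl_left z (e ▸ hxz)
    have hqz : q = z := by
      have := h.deg_right y x z q (sO _ _ hxy) hO hyq
      grind
    subst hqz
    have hwq : ¬ A w q := fun hh => by
      have := h.deg_left w x y q (sA _ _ hxw) (sA _ _ hAyw) hh
      have := h.irrefl_right
      grind
    refine h.path_path x y q w ⟨hxy, hxy'⟩ ⟨hyq, hyq'⟩ ⟨?_, ?_⟩ ⟨sA _ _ hxz, ?_⟩
      ⟨hxw, hxw'⟩ ⟨sA _ _ hAyw, ?_⟩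
    all_goals grind

/-- When neither triangle has a free corner, this applies both ways: `x` and `y` then share the
`A`-neighbours `z` and `w`, the only kind of conflict that needs a tie-break. -/
theorem IsMixedCorner.onlyFirst_of_conflict (h : IsExchangeFree A O) {x y z w : V}
    (hz : IsMixedCorner A O x y z) (hw : IsMixedCorner A O x y w) (hne : z ≠ w)
    (nw : ¬ HasFreeCorner A O x y w) : OnlyFirst A O y z := by
  have hO : ¬ O y z := fun hO => by
    have := hz.isFreeCorner_of_conflict h hw hne hO
    unfold HasFreeCorner at nw
    tauto
  exact ⟨hz.2.2.resolve_right hO, hO⟩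

/-- A corner that is free, or whose triangle has no free corner and which wins the comparisons,
by a fixed order of the nodes, with the conflicting corners of such triangles. -/
def IsSelectedCorner {V : Type*} [LinearOrder V] (A O : V → V → Prop) (x y z : V) : Prop :=
  IsMixedCorner A O x y z ∧ (IsFreeCorner A O x y z ∨
    ¬ HasFreeCorner A O x y z ∧
    (∀ w, w ≠ z → IsMixedCorner A O x y w → ¬ HasFreeCorner A O x y w → (x < y ↔ z < w)) ∧
    ∀ u, u ≠ y → IsMixedCorner A O x u z → ¬ HasFreeCorner A O x u z → (x < z ↔ y < u))

theorem isSelectedCorner_swap [LinearOrder V] (x y z : V) (h : IsExchangeFree A O) :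
    IsSelectedCorner O A x z y ↔ IsSelectedCorner A O x y z := by
  simp only [IsSelectedCorner, isMixedCorner_swap _ _ _ h, isFreeCorner_swap _ _ _ h,
    hasFreeCorner_swap _ _ _ h]
  tauto

theorem IsSelectedCorner.right_unique [LinearOrder V] {x y z w : V}
    (hz : IsSelectedCorner A O x y z) (hw : IsSelectedCorner A O x y w) : z = w := by
  by_contra hne
  obtain ⟨cz, fz | ⟨nz, hz, -⟩⟩ := hz
  · exact hne (fz.2.1 _ hw.1).symm
  obtain ⟨cw, fw | ⟨nw, hw, -⟩⟩ := hw
  · exact hne (fw.2.1 _ cz)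
  have h1 := hz w (Ne.symm hne) cw nw
  have h2 := hw z hne cz nz
  rcases lt_or_gt_of_ne hne with hlt | hlt
  · exact lt_asymm hlt (h2.1 (h1.2 hlt))
  · exact lt_asymm hlt (h1.1 (h2.2 hlt))

theorem IsSelectedCorner.left_unique [LinearOrder V] (h : IsExchangeFree A O) {x y u z : V}
    (hy : IsSelectedCorner A O x y z) (hu : IsSelectedCorner A O x u z) : y = u :=
  IsSelectedCorner.right_unique ((isSelectedCorner_swap _ _ _ h).2 hy)
    ((isSelectedCorner_swap _ _ _ h).2 hu)

/-- The corners at `x` and `y` are both mixed and share the `O`-edge `xy`. A competing triangle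
`xyw` competes at both ends, and the order test has opposite outcomes there, so one end goes to each
triangle. -/
theorem IsMixedCorner.exists_isSelectedCorner_of_onlyFirst [LinearOrder V] (h : IsExchangeFree A O)
    {x y z : V} (hc : IsMixedCorner A O x y z) (hn : ¬ HasFreeCorner A O x y z) (hyz : ¬ O y z) :
    IsSelectedCorner A O x y z ∨ IsSelectedCorner A O y x z := by
  have sA := h.symm_left
  have sO := h.symm_right
  have hAyz : A y z := hc.2.2.resolve_right hyz
  obtain ⟨⟨hxy, hxy'⟩, ⟨hxz, hxz'⟩, -⟩ := id hc
  have hc' : IsMixedCorner A O y x z := ⟨⟨sO _ _ hxy, by grind⟩, ⟨hAyz, hyz⟩, Or.inl hxz⟩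
  have hn' : ¬ HasFreeCorner A O y x z := by rwa [hasFreeCorner_comm_left]
  -- A conflict along the `A`-edge would, by the dual of `IsMixedCorner.onlyFirst_of_conflict`, put
  -- the opposite side `qz` into `O`.
  have left_conflict {p q : V} (hpq : IsMixedCorner A O p q z) (hq : ¬ O q z) (u : V) (hu : u ≠ q)
      (hcu : IsMixedCorner A O p u z) (nu : ¬ HasFreeCorner A O p u z) : False := by
    have hh := IsMixedCorner.onlyFirst_of_conflict h.swap ((isMixedCorner_swap _ _ _ h).2 hpq)
      ((isMixedCorner_swap _ _ _ h).2 hcu) hu.symm (by rwa [hasFreeCorner_swap _ _ _ h])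
    exact hq (sO _ _ hh.1)
  by_cases hw : ∃ w, w ≠ z ∧ IsMixedCorner A O x y w ∧ ¬ HasFreeCorner A O x y w
  · obtain ⟨w, hwz, hcw, hnw⟩ := hw
    have hyw := hcw.onlyFirst_of_conflict h hc hwz hn
    have hxw := hcw.2.1
    have hxy_ne : x ≠ y := fun e => h.irrefl_right y (e ▸ hxy)
    by_cases ho : x < y ↔ z < w
    · left
      refine ⟨hc, Or.inr ⟨hn, fun w' hw' hcw' _ => ?_, fun u hu hcu nu => ?_⟩⟩
      · have hw'w : w' = w := by
          have := h.deg_left x z w w' hxz hxw.1 hcw'.2.1.1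
          grind
        rwa [hw'w]
      · exact (left_conflict hc hyz u hu hcu nu).elim
    · right
      refine ⟨hc', Or.inr ⟨hn', fun w' hw' hcw' _ => ?_, fun u hu hcu nu => ?_⟩⟩
      · have hw'w : w' = w := by
          have := h.deg_left y z w w' hAyz hyw.1 hcw'.2.1.1
          grind
        rw [hw'w]
        grind
      · exact (left_conflict hc' hxz' u hu hcu nu).elim
  · left
    push Not at hw
    exact ⟨hc, Or.inr ⟨hn, fun w hwz hcw hnw => (hnw (hw w hwz hcw)).elim,
      fun u hu hcu nu => (left_conflict hc hyz u hu hcu nu).elim⟩⟩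

theorem IsMixedCorner.exists_isSelectedCorner [LinearOrder V] (h : IsExchangeFree A O)
    {x y z : V} (hc : IsMixedCorner A O x y z) :
    IsSelectedCorner A O x y z ∨ IsSelectedCorner A O y x z ∨ IsSelectedCorner A O z y x := by
  have sA := h.symm_left
  have sO := h.symm_right
  obtain ⟨⟨hxy, hxy'⟩, ⟨hxz, hxz'⟩, hyz⟩ := id hc
  by_cases hn : HasFreeCorner A O x y z
  · rcases hn with hf | hf | hf | hf | hf | hf
    · exact Or.inl ⟨hf.1, Or.inl hf⟩
    · exact (hxz' hf.1.1.1).elim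
    · exact Or.inr (Or.inl ⟨hf.1, Or.inl hf⟩)
    · exact (hxy' (sA _ _ hf.1.2.1.1)).elim
    · exact (hxz' (sO _ _ hf.1.1.1)).elim
    · exact Or.inr (Or.inr ⟨hf.1, Or.inl hf⟩)
  by_cases hO : O y z
  -- A side in both relations rules out every conflict with a triangle that has no free corner,
  -- since such a conflict makes that side belong to one relation only.
  · by_cases hA : A y z
    · left
      refine ⟨hc, Or.inr ⟨hn, fun w hwz hcw hnw => ?_, fun u hu hcu hnu => ?_⟩⟩
      · exact ((hc.onlyFirst_of_conflict h hcw hwz.symm hnw).2 hO).elim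
      · have hh := IsMixedCorner.onlyFirst_of_conflict h.swap ((isMixedCorner_swap _ _ _ h).2 hc)
          ((isMixedCorner_swap _ _ _ h).2 hcu) hu.symm (by rwa [hasFreeCorner_swap _ _ _ h])
        exact (hh.2 (sA _ _ hA)).elim
    · have := IsMixedCorner.exists_isSelectedCorner_of_onlyFirst h.swap
        ((isMixedCorner_swap _ _ _ h).2 hc) (by rwa [hasFreeCorner_swap _ _ _ h])
        (fun hh => hA (sA _ _ hh))
      rw [isSelectedCorner_swap _ _ _ h, isSelectedCorner_swap _ _ _ h] at this
      tauto
  · have := hc.exists_isSelectedCorner_of_onlyFirst h hn hO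
    tauto

end Corners

/-! ### Pairings at the nodes that hit every triangle -/

/-- At every node, `π x` is a maximal matching between the `O`-only and the `A`-only neighbours
of `x`, and every triangle with a corner has a corner whose edges are matched. -/
structure IsPairing {V : Type*} (A O : V → V → Prop) (π : V → V → V → Prop) : Prop where
  left : ∀ x y z, π x y z → OnlyFirst O A x y
  right : ∀ x y z, π x y z → OnlyFirst A O x z
  right_unique : ∀ x y z w, π x y z → π x y w → z = w
  left_unique : ∀ x y u z, π x y z → π x u z → y = u
  maximal : ∀ x, (∀ y, OnlyFirst O A x y → ∃ z, π x y z) ∨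
    ∀ z, OnlyFirst A O x z → ∃ y, π x y z
  hits : ∀ x y z, IsMixedCorner A O x y z → π x y z ∨ π y x z ∨ π z y x

section Pairing

variable {V : Type*} {A O : V → V → Prop}

theorem IsPairing.swap {π : V → V → V → Prop} (h : IsExchangeFree A O) (hπ : IsPairing A O π) :
    IsPairing O A (fun x y z => π x z y) where
  left x y z := hπ.right x z y
  right x y z := hπ.left x z y
  right_unique x y z w := hπ.left_unique x z w y
  left_unique x y u z := hπ.right_unique x z y u
  maximal x := (hπ.maximal x).symm
  hits x y z hc := by
    have := hπ.hits x z y ((isMixedCorner_swap _ _ _ h.swap).2 hc)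
    tauto

/-- A partial matching between two sets is contained in a matching that covers one of them. -/
theorem exists_matching_covering {V : Type*} [Finite V] (P Q : V → Prop) (S : V → V → Prop)
    (hP : ∀ y z, S y z → P y) (hQ : ∀ y z, S y z → Q z)
    (hr : ∀ y z w, S y z → S y w → z = w) (hl : ∀ y u z, S y z → S u z → y = u) :
    ∃ T : V → V → Prop, (∀ y z, S y z → T y z) ∧ (∀ y z, T y z → P y) ∧ (∀ y z, T y z → Q z) ∧
      (∀ y z w, T y z → T y w → z = w) ∧ (∀ y u z, T y z → T u z → y = u) ∧
      ((∀ y, P y → ∃ z, T y z) ∨ ∀ z, Q z → ∃ y, T y z) := by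
  let F : Set (V → V → Prop) := {T | (∀ y z, S y z → T y z) ∧ (∀ y z, T y z → P y) ∧
    (∀ y z, T y z → Q z) ∧ (∀ y z w, T y z → T y w → z = w) ∧ ∀ y u z, T y z → T u z → y = u}
  have hF : F.Nonempty := ⟨S, fun _ _ h => h, hP, hQ, hr, hl⟩
  obtain ⟨T, ⟨hST, hTP, hTQ, hTr, hTl⟩, hmax⟩ := (Set.toFinite F).exists_maximal hF
  refine ⟨T, hST, hTP, hTQ, hTr, hTl, ?_⟩
  by_contra hcon
  push Not at hcon
  obtain ⟨⟨y, hy, hyT⟩, z, hz, hzT⟩ := hcon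
  have hT' : (fun p q => T p q ∨ p = y ∧ q = z) ∈ F := by
    refine ⟨?_, ?_, ?_, ?_, ?_⟩ <;> grind
  exact hyT z (hmax hT' (fun p q h => Or.inl h) y z (Or.inr ⟨rfl, rfl⟩))

theorem IsExchangeFree.exists_isPairing [Finite V] (h : IsExchangeFree A O) :
    ∃ π, IsPairing A O π := by
  classical
  let _ : LinearOrder V := linearOrderOfSTO WellOrderingRel
  have key (x : V) := exists_matching_covering (OnlyFirst O A x) (OnlyFirst A O x)
    (IsSelectedCorner A O x) (fun _ _ hs => hs.1.1) (fun _ _ hs => hs.1.2.1)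
    (fun _ _ _ h1 h2 => h1.right_unique h2) (fun _ _ _ h1 h2 => h1.left_unique h h2)
  choose π hS hP hQ hr hl hm using key
  refine ⟨π, hP, hQ, hr, hl, hm, fun x y z hc => ?_⟩
  rcases hc.exists_isSelectedCorner h with hs | hs | hs
  · exact Or.inl (hS _ _ _ hs)
  · exact Or.inr (Or.inl (hS _ _ _ hs))
  · exact Or.inr (Or.inr (hS _ _ _ hs))

end Pairing

/-! ### Excluding exchangeable four-cycles by the choice of `O` -/

/-- The adjacency relation of a set of edges. -/
def EdgeRel {V : Type*} (M : Finset (Sym2 V)) (x y : V) : Prop := s(x, y) ∈ M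

section Matchings

variable {V : Type*} [DecidableEq V] {G : SimpleGraph V}

theorem isTriangleFreeTwoMatching_iff {M : Finset (Sym2 V)} :
    IsTriangleFreeTwoMatching G M ↔ (∀ x y, s(x, y) ∈ M → G.Adj x y) ∧
      (∀ x p q r, s(x, p) ∈ M → s(x, q) ∈ M → s(x, r) ∈ M → p = q ∨ p = r ∨ q = r) ∧
      ∀ x y z, s(x, y) ∈ M → s(x, z) ∈ M → s(y, z) ∈ M → False := by
  unfold IsTriangleFreeTwoMatching IsTwoMatching
  have h1 : (M : Set (Sym2 V)) ⊆ G.edgeSet ↔ ∀ x y, s(x, y) ∈ M → G.Adj x y := by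
    constructor
    · intro h x y hxy
      exact h hxy
    · intro h e
      induction e with
      | _ x y => exact h x y
  have h2 (x : V) : #{e ∈ M | x ∈ e} ≤ 2 ↔
      ∀ p q r, s(x, p) ∈ M → s(x, q) ∈ M → s(x, r) ∈ M → p = q ∨ p = r ∨ q = r := by
    rw [← not_lt, Finset.two_lt_card_iff]
    simp only [mem_filter]
    constructor
    · intro h p q r hp hq hr
      by_contra hcon
      push Not at hcon
      exact h ⟨s(x, p), s(x, q), s(x, r), by simp_all⟩
    · rintro h ⟨_, _, _, ⟨ha, p, rfl⟩, ⟨hb, q, rfl⟩, ⟨hc, r, rfl⟩, hab, hac, hbc⟩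
      rcases h p q r ha hb hc with rfl | rfl | rfl
      exacts [hab rfl, hac rfl, hbc rfl]
  rw [h1, and_assoc]
  refine and_congr_right fun hG => and_congr (forall_congr' h2) ?_
  have hne (x y : V) (h : s(x, y) ∈ M) : x ≠ y := (hG x y h).ne
  constructor
  · intro h x y z hxy hxz hyz
    refine h {x, y, z} (SimpleGraph.is3Clique_iff.2 ⟨x, y, z, ?_, ?_, ?_, rfl⟩) <;>
      simp_all [SimpleGraph.fromEdgeSet_adj]
  · intro h t ht
    obtain ⟨x, y, z, hxy, hxz, hyz, -⟩ := SimpleGraph.is3Clique_iff.1 ht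
    simp only [SimpleGraph.fromEdgeSet_adj, mem_coe] at hxy hxz hyz
    exact h x y z hxy.1 hxz.1 hyz.1

omit [DecidableEq V] in
/-- An injection of the neighbours in `N` into the neighbours in `M` transfers the degree bound. -/
theorem degree_le_two_of_injOn {M N : Finset (Sym2 V)} {x : V}
    (hM : ∀ p q r, s(x, p) ∈ M → s(x, q) ∈ M → s(x, r) ∈ M → p = q ∨ p = r ∨ q = r)
    (φ : V → V) (hφ : ∀ y, s(x, y) ∈ N → s(x, φ y) ∈ M)
    (hinj : ∀ y z, s(x, y) ∈ N → s(x, z) ∈ N → φ y = φ z → y = z) (p q r : V)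
    (hp : s(x, p) ∈ N) (hq : s(x, q) ∈ N) (hr : s(x, r) ∈ N) : p = q ∨ p = r ∨ q = r := by
  rcases hM _ _ _ (hφ p hp) (hφ q hq) (hφ r hr) with h | h | h
  · exact Or.inl (hinj _ _ hp hq h)
  · exact Or.inr (Or.inl (hinj _ _ hp hr h))
  · exact Or.inr (Or.inr (hinj _ _ hq hr h))

omit [DecidableEq V] in
theorem deg_le_two_replace {P : V → Prop}
    (hP : ∀ a b c, P a → P b → P c → a = b ∨ a = c ∨ b = c) {q s : V} (hq : P q) (a b c : V) :
    P a ∧ a ≠ q ∨ a = s → P b ∧ b ≠ q ∨ b = s → P c ∧ c ≠ q ∨ c = s →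
      a = b ∨ a = c ∨ b = c := by
  have h1 := hP a b q
  have h2 := hP a c q
  have h3 := hP b c q
  grind

variable {A O : Finset (Sym2 V)}

/-- Exchanging the four-cycle keeps degrees and cardinality and increases the overlap with `A`. Each
new edge has exactly one of the opposite nodes `p`, `r` as an end; `hcommon` uses up the remaining
`O`-degrees, so no new edge closes a triangle. -/
theorem not_alternating_fourCycle (hA : IsTriangleFreeTwoMatching G A)
    (hO : IsMaximumTriangleFreeTwoMatching G O)
    (hinter : ∀ M, IsMaximumTriangleFreeTwoMatching G M → #(M ∩ A) ≤ #(O ∩ A)) {p q r s : V}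
    (hpq : OnlyFirst (EdgeRel O) (EdgeRel A) p q) (hqr : OnlyFirst (EdgeRel A) (EdgeRel O) q r)
    (hrs : OnlyFirst (EdgeRel O) (EdgeRel A) r s) (hsp : OnlyFirst (EdgeRel A) (EdgeRel O) s p)
    (hcommon : s(p, r) ∈ O ∨ ∃ d, s(p, d) ∈ O ∧ s(r, d) ∈ O) : False := by
  obtain ⟨hAG, hAdeg, hAtri⟩ := isTriangleFreeTwoMatching_iff.1 hA
  obtain ⟨hOG, hOdeg, hOtri⟩ := isTriangleFreeTwoMatching_iff.1 hO.1
  simp only [OnlyFirst, EdgeRel] at hpq hqr hrs hsp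
  have npq : p ≠ q := (hOG _ _ hpq.1).ne
  have nqr : q ≠ r := (hAG _ _ hqr.1).ne
  have nrs : r ≠ s := (hOG _ _ hrs.1).ne
  have nsp : s ≠ p := (hAG _ _ hsp.1).ne
  have npr : p ≠ r := by
    rintro rfl
    exact hpq.2 (Sym2.eq_swap ▸ hqr.1)
  have nqs : q ≠ s := by
    rintro rfl
    exact hpq.2 (Sym2.eq_swap ▸ hsp.1)
  set N : Finset (Sym2 V) := (O \ {s(p, q), s(r, s)}) ∪ {s(q, r), s(s, p)} with hN
  have mem (x y : V) : s(x, y) ∈ N ↔ (s(x, y) ∈ O ∧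
      ¬ (x = p ∧ y = q ∨ x = q ∧ y = p) ∧ ¬ (x = r ∧ y = s ∨ x = s ∧ y = r)) ∨
      (x = q ∧ y = r ∨ x = r ∧ y = q) ∨ (x = s ∧ y = p ∨ x = p ∧ y = s) := by
    simp only [hN, mem_union, mem_sdiff, mem_insert, mem_singleton, Sym2.eq_iff, not_or]
  have sO (x y : V) (h : s(x, y) ∈ O) : s(y, x) ∈ O := Sym2.eq_swap ▸ h
  have Np (y : V) : s(p, y) ∈ N ↔ s(p, y) ∈ O ∧ y ≠ q ∨ y = s := by rw [mem]; grind
  have Nq (y : V) : s(q, y) ∈ N ↔ s(q, y) ∈ O ∧ y ≠ p ∨ y = r := by rw [mem]; grind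
  have Nr (y : V) : s(r, y) ∈ N ↔ s(r, y) ∈ O ∧ y ≠ s ∨ y = q := by rw [mem]; grind
  have Ns (y : V) : s(s, y) ∈ N ↔ s(s, y) ∈ O ∧ y ≠ r ∨ y = p := by rw [mem]; grind
  have hNdeg (x a b c : V) : s(x, a) ∈ N → s(x, b) ∈ N → s(x, c) ∈ N →
      a = b ∨ a = c ∨ b = c := by
    by_cases hxp : x = p
    · subst hxp
      simp only [Np]
      exact deg_le_two_replace (hOdeg x) hpq.1 _ _ _
    by_cases hxq : x = q
    · subst hxq
      simp only [Nq]
      exact deg_le_two_replace (hOdeg x) (sO _ _ hpq.1) _ _ _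
    by_cases hxr : x = r
    · subst hxr
      simp only [Nr]
      exact deg_le_two_replace (hOdeg x) hrs.1 _ _ _
    by_cases hxs : x = s
    · subst hxs
      simp only [Ns]
      exact deg_le_two_replace (hOdeg x) (sO _ _ hrs.1) _ _ _
    · have hx (y : V) : s(x, y) ∈ N ↔ s(x, y) ∈ O := by rw [mem]; grind
      simp only [hx]
      exact hOdeg x a b c
  have htri_qr (t : V) (hq : s(q, t) ∈ N) (hr : s(r, t) ∈ N) : False := by
    rw [Nq] at hq
    rw [Nr] at hr
    have h1 : s(q, t) ∈ O ∧ t ≠ p := by grind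
    have h2 : s(r, t) ∈ O ∧ t ≠ s := by grind
    rcases hcommon with h | ⟨d, hpd, hrd⟩
    · have := hOdeg r s t p hrs.1 h2.1 (sO _ _ h)
      grind
    · have h3 := hOdeg r s t d hrs.1 h2.1 hrd
      have h4 : t = d := by grind
      subst h4
      have := hOdeg t q p r (sO _ _ h1.1) (sO _ _ hpd) (sO _ _ hrd)
      grind
  have htri_sp (t : V) (hs : s(s, t) ∈ N) (hp : s(p, t) ∈ N) : False := by
    rw [Ns] at hs
    rw [Np] at hp
    have h1 : s(s, t) ∈ O ∧ t ≠ r := by grind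
    have h2 : s(p, t) ∈ O ∧ t ≠ q := by grind
    rcases hcommon with h | ⟨d, hpd, hrd⟩
    · have := hOdeg p q t r hpq.1 h2.1 h
      grind
    · have h3 := hOdeg p q t d hpq.1 h2.1 hpd
      have h4 : t = d := by grind
      subst h4
      have := hOdeg t s p r (sO _ _ h1.1) (sO _ _ hpd) (sO _ _ hrd)
      grind
  have sN (x y : V) (h : s(x, y) ∈ N) : s(y, x) ∈ N := Sym2.eq_swap ▸ h
  have old (x y t : V) (hxy : s(x, y) ∈ N) (hx : s(x, t) ∈ N) (hy : s(y, t) ∈ N) :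
      s(x, y) ∈ O := by
    rw [mem] at hxy
    rcases hxy with h | (⟨rfl, rfl⟩ | ⟨rfl, rfl⟩) | ⟨rfl, rfl⟩ | ⟨rfl, rfl⟩
    exacts [h.1, (htri_qr t hx hy).elim, (htri_qr t hy hx).elim, (htri_sp t hx hy).elim,
      (htri_sp t hy hx).elim]
  have hNtri (x y z : V) (hxy : s(x, y) ∈ N) (hxz : s(x, z) ∈ N) (hyz : s(y, z) ∈ N) : False :=
    hOtri x y z (old x y z hxy hxz hyz) (old x z y hxz hxy (sN _ _ hyz))
      (old y z x hyz (sN _ _ hxy) (sN _ _ hxz))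
  have hNG (x y : V) (h : s(x, y) ∈ N) : G.Adj x y := by
    rw [mem] at h
    rcases h with h | (⟨rfl, rfl⟩ | ⟨rfl, rfl⟩) | ⟨rfl, rfl⟩ | ⟨rfl, rfl⟩
    exacts [hOG _ _ h.1, hAG _ _ hqr.1, (hAG _ _ hqr.1).symm, hAG _ _ hsp.1, (hAG _ _ hsp.1).symm]
  have hNM : IsTriangleFreeTwoMatching G N := isTriangleFreeTwoMatching_iff.2 ⟨hNG, hNdeg, hNtri⟩
  have hne : s(p, q) ≠ s(r, s) := by simp [npr, nsp.symm]
  have hne' : s(q, r) ≠ s(s, p) := by simp [nqs, npq.symm]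
  have hcard : #N = #O := by
    rw [hN, card_union_of_disjoint, card_sdiff_of_subset, card_pair hne, card_pair hne']
    · have : #({s(p, q), s(r, s)} : Finset (Sym2 V)) ≤ #O := card_le_card (by
        intro e; simp only [mem_insert, mem_singleton]; rintro (rfl | rfl); exacts [hpq.1, hrs.1])
      rw [card_pair hne] at this
      omega
    · intro e; simp only [mem_insert, mem_singleton]; rintro (rfl | rfl); exacts [hpq.1, hrs.1]
    · rw [disjoint_left]
      intro e he he'
      simp only [mem_insert, mem_singleton, mem_sdiff] at he he'
      rcases he' with rfl | rfl
      exacts [hqr.2 he.1, hsp.2 he.1]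
  have hle := hinter N ⟨hNM, fun M hM => hcard ▸ hO.2 M hM⟩
  have hlt : #(O ∩ A) < #(N ∩ A) := by
    refine card_lt_card (Finset.ssubset_iff_of_subset ?_ |>.2 ⟨s(q, r), ?_, ?_⟩)
    · intro e
      simp only [hN, mem_inter, mem_union, mem_sdiff, mem_insert, mem_singleton]
      rintro ⟨h1, h2⟩
      refine ⟨Or.inl ⟨h1, ?_⟩, h2⟩
      rintro (rfl | rfl)
      exacts [hpq.2 h2, hrs.2 h2]
    · simp [hN, hqr.1]
    · simp [hqr.2]
  omega

theorem isExchangeFree_edgeRel (hA : IsTriangleFreeTwoMatching G A)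
    (hO : IsMaximumTriangleFreeTwoMatching G O)
    (hinter : ∀ M, IsMaximumTriangleFreeTwoMatching G M → #(M ∩ A) ≤ #(O ∩ A)) :
    IsExchangeFree (EdgeRel A) (EdgeRel O) := by
  obtain ⟨hAG, hAdeg, -⟩ := isTriangleFreeTwoMatching_iff.1 hA
  obtain ⟨hOG, hOdeg, -⟩ := isTriangleFreeTwoMatching_iff.1 hO.1
  have sO (x y : V) (h : OnlyFirst (EdgeRel O) (EdgeRel A) x y) :
      OnlyFirst (EdgeRel O) (EdgeRel A) y x := by
    unfold OnlyFirst EdgeRel at *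
    rwa [Sym2.eq_swap]
  have sA (x y : V) (h : OnlyFirst (EdgeRel A) (EdgeRel O) x y) :
      OnlyFirst (EdgeRel A) (EdgeRel O) y x := by
    unfold OnlyFirst EdgeRel at *
    rwa [Sym2.eq_swap]
  -- The middle edge `qr` of the `O`-path joins opposite nodes of the alternating cycle `q p r s`.
  have path (p q r s : V) (h1 : OnlyFirst (EdgeRel O) (EdgeRel A) p q)
      (h2 : OnlyFirst (EdgeRel O) (EdgeRel A) q r) (h3 : OnlyFirst (EdgeRel O) (EdgeRel A) r s)
      (h4 : OnlyFirst (EdgeRel A) (EdgeRel O) p r) (h5 : OnlyFirst (EdgeRel A) (EdgeRel O) q s) :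
      False :=
    not_alternating_fourCycle hA hO hinter (sO _ _ h1) h4 h3 (sA _ _ h5) (Or.inl h2.1)
  refine ⟨?_, ?_, ?_, ?_, hAdeg, hOdeg, ?_, ?_, ?_⟩
  · intro x y h
    unfold EdgeRel at *
    rwa [Sym2.eq_swap]
  · intro x y h
    unfold EdgeRel at *
    rwa [Sym2.eq_swap]
  · exact fun x h => (hAG _ _ h).ne rfl
  · exact fun x h => (hOG _ _ h).ne rfl
  · exact fun p q r s h1 h2 h3 h4 _ h6 => path p q r s h1 h2 h3 (sA _ _ h4) (sA _ _ h6)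
  · exact fun p q r s d h1 _ h3 h4 h5 h6 h7 =>
      not_alternating_fourCycle hA hO hinter (sO _ _ h4) h1 h5 (sA _ _ h3)
        (Or.inr ⟨d, h7.1, h6.1⟩)
  · exact fun p q r s _ h1 h2 h3 h4 h5 _ _ => path p q r s h1 h2 h3 h4 h5

end Matchings

/-! ### Closed edge sets and their augmenting trails -/

/-- A set of edges that contains, with every edge, the edges paired with it at its two ends. -/
def IsClosedUnder {V : Type*} (π : V → V → V → Prop) (K : Finset (Sym2 V)) : Prop :=
  ∀ x y z, π x y z → (s(x, y) ∈ K ↔ s(x, z) ∈ K)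

section Closed

variable {V : Type*} [DecidableEq V] {G : SimpleGraph V} {A O K : Finset (Sym2 V)}
  {π : V → V → V → Prop}

theorem IsClosedUnder.sdiff {L : Finset (Sym2 V)} (hK : IsClosedUnder π K)
    (hL : IsClosedUnder π L) : IsClosedUnder π (K \ L) := by
  intro x y z h
  rw [mem_sdiff, mem_sdiff, hK x y z h, hL x y z h]

/-- A triangle in the union of two triangle-free edge sets has two sides that lie in exactly one
of the sets each, but not in the same one. -/
theorem exists_isMixedCorner (hA : IsTriangleFreeTwoMatching G A)
    (hO : IsTriangleFreeTwoMatching G O) {x y z : V} (hxy : s(x, y) ∈ A ∨ s(x, y) ∈ O)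
    (hxz : s(x, z) ∈ A ∨ s(x, z) ∈ O) (hyz : s(y, z) ∈ A ∨ s(y, z) ∈ O) :
    IsMixedCorner (EdgeRel A) (EdgeRel O) x y z ∨ IsMixedCorner (EdgeRel A) (EdgeRel O) x z y ∨
    IsMixedCorner (EdgeRel A) (EdgeRel O) y x z ∨ IsMixedCorner (EdgeRel A) (EdgeRel O) y z x ∨
    IsMixedCorner (EdgeRel A) (EdgeRel O) z x y ∨ IsMixedCorner (EdgeRel A) (EdgeRel O) z y x := by
  have h1 := (isTriangleFreeTwoMatching_iff.1 hA).2.2 x y z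
  have h2 := (isTriangleFreeTwoMatching_iff.1 hO).2.2 x y z
  simp only [IsMixedCorner, OnlyFirst, EdgeRel]
  rw [Sym2.eq_swap (a := y) (b := x), Sym2.eq_swap (a := z) (b := x),
    Sym2.eq_swap (a := z) (b := y)]
  clear hA hO
  by_cases a1 : s(x, y) ∈ A <;> by_cases a2 : s(x, z) ∈ A <;> by_cases a3 : s(y, z) ∈ A <;>
    by_cases o1 : s(x, y) ∈ O <;> by_cases o2 : s(x, z) ∈ O <;> by_cases o3 : s(y, z) ∈ O <;>
    simp_all

/-- Two paired edges are both in `K` or both outside, so exactly one of them is in `A ∆ K`. This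
breaks every triangle, because each contains a pair. -/
theorem IsClosedUnder.isTriangleFreeTwoMatching_symmDiff (hA : IsTriangleFreeTwoMatching G A)
    (hO : IsTriangleFreeTwoMatching G O) (hπ : IsPairing (EdgeRel A) (EdgeRel O) π)
    (hK : IsClosedUnder π K) (hKD : K ⊆ A ∆ O) : IsTriangleFreeTwoMatching G (A ∆ K) := by
  obtain ⟨hAG, hAdeg, -⟩ := isTriangleFreeTwoMatching_iff.1 hA
  obtain ⟨hOG, hOdeg, -⟩ := isTriangleFreeTwoMatching_iff.1 hO
  have mem (e : Sym2 V) : e ∈ A ∆ K ↔ e ∈ A ∧ e ∉ K ∨ e ∉ A ∧ e ∈ O ∧ e ∈ K := by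
    have := @hKD e
    simp only [mem_symmDiff] at this ⊢
    tauto
  have union (e : Sym2 V) (he : e ∈ A ∆ K) : e ∈ A ∨ e ∈ O := by
    rw [mem] at he
    tauto
  have not_both (x y z : V) (h : π x y z) (hy : s(x, y) ∈ A ∆ K) (hz : s(x, z) ∈ A ∆ K) :
      False := by
    have h1 := hπ.left _ _ _ h
    have h2 := hπ.right _ _ _ h
    have h3 := hK _ _ _ h
    simp only [OnlyFirst, EdgeRel] at h1 h2
    rw [mem] at hy hz
    tauto
  refine isTriangleFreeTwoMatching_iff.2 ⟨?_, ?_, ?_⟩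
  · intro x y h
    exact (union _ h).elim (hAG x y) (hOG x y)
  · intro x
    -- If all `O`-only edges at `x` are paired, each new edge replaces its removed partner and the
    -- degree bound of `A` applies. Otherwise all `A`-only edges are paired, each surviving one
    -- stands for its absent partner, and the bound of `O` applies.
    rcases hπ.maximal x with hm | hm
    · choose! g hg using hm
      have hnew (y : V) (hy : s(x, y) ∈ A ∆ K) (hyA : s(x, y) ∉ A) : π x y (g y) :=
        hg y ⟨(union _ hy).resolve_left hyA, hyA⟩
      refine degree_le_two_of_injOn (hAdeg x) (fun y => if s(x, y) ∈ A then y else g y) ?_ ?_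
      · intro y hy
        by_cases hyA : s(x, y) ∈ A
        · simp [hyA]
        · rw [if_neg hyA]
          exact (hπ.right _ _ _ (hnew y hy hyA)).1
      · intro y z hy hz
        by_cases hyA : s(x, y) ∈ A <;> by_cases hzA : s(x, z) ∈ A <;> simp only [hyA, hzA, if_true,
          if_false]
        · exact id
        · rintro rfl
          exact (not_both _ _ _ (hnew z hz hzA) hz hy).elim
        · rintro rfl
          exact (not_both _ _ _ (hnew y hy hyA) hy hz).elim
        · intro e
          exact hπ.left_unique _ _ _ _ (hnew y hy hyA) (e ▸ hnew z hz hzA)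
    · choose! g hg using hm
      have hnew (y : V) (hy : s(x, y) ∈ A ∆ K) (hyO : s(x, y) ∉ O) : π x (g y) y :=
        hg y ⟨(union _ hy).resolve_right hyO, hyO⟩
      refine degree_le_two_of_injOn (hOdeg x) (fun y => if s(x, y) ∈ O then y else g y) ?_ ?_
      · intro y hy
        by_cases hyO : s(x, y) ∈ O
        · simp [hyO]
        · rw [if_neg hyO]
          exact (hπ.left _ _ _ (hnew y hy hyO)).1
      · intro y z hy hz
        by_cases hyO : s(x, y) ∈ O <;> by_cases hzO : s(x, z) ∈ O <;> simp only [hyO, hzO, if_true,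
          if_false]
        · exact id
        · rintro rfl
          exact (not_both _ _ _ (hnew z hz hzO) hy hz).elim
        · rintro rfl
          exact (not_both _ _ _ (hnew y hy hyO) hz hy).elim
        · intro e
          exact hπ.right_unique _ _ _ _ (hnew y hy hyO) (e ▸ hnew z hz hzO)
  · intro x y z hxy hxz hyz
    have hyx : s(y, x) ∈ A ∆ K := Sym2.eq_swap ▸ hxy
    have hzx : s(z, x) ∈ A ∆ K := Sym2.eq_swap ▸ hxz
    have hzy : s(z, y) ∈ A ∆ K := Sym2.eq_swap ▸ hyz
    have hcorner (p q r : V) (hc : IsMixedCorner (EdgeRel A) (EdgeRel O) p q r)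
        (hpq : s(p, q) ∈ A ∆ K) (hpr : s(p, r) ∈ A ∆ K) (hqr : s(q, r) ∈ A ∆ K) : False := by
      rcases hπ.hits _ _ _ hc with h | h | h
      · exact not_both _ _ _ h hpq hpr
      · exact not_both _ _ _ h (Sym2.eq_swap ▸ hpq) hqr
      · exact not_both _ _ _ h (Sym2.eq_swap ▸ hqr) (Sym2.eq_swap ▸ hpr)
    rcases exists_isMixedCorner hA hO (union _ hxy) (union _ hxz) (union _ hyz) with
      h | h | h | h | h | h
    exacts [hcorner _ _ _ h hxy hxz hyz, hcorner _ _ _ h hxz hxy hzy, hcorner _ _ _ h hyx hyz hxz,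
      hcorner _ _ _ h hyz hyx hzx, hcorner _ _ _ h hzx hzy hxy, hcorner _ _ _ h hzy hzx hyx]

theorem card_symmDiff_add_card_filter {α : Type*} [DecidableEq α] (M K : Finset α) :
    #(M ∆ K) + #{e ∈ K | e ∈ M} = #M + #{e ∈ K | e ∉ M} := by
  have h1 : M ∆ K = (M \ {e ∈ K | e ∈ M}) ∪ {e ∈ K | e ∉ M} := by
    ext e
    simp only [mem_symmDiff, mem_union, mem_sdiff, mem_filter]
    tauto
  have h2 : {e ∈ K | e ∈ M} ⊆ M := fun e he => (mem_filter.1 he).2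
  have h3 : Disjoint (M \ {e ∈ K | e ∈ M}) {e ∈ K | e ∉ M} := by
    rw [disjoint_left]
    intro e he he'
    exact (mem_filter.1 he').2 (mem_sdiff.1 he).1
  have h4 := card_le_card h2
  rw [h1, card_union_of_disjoint h3, card_sdiff_of_subset h2]
  omega

/-- By duality `O ∆ K` is also a triangle-free 2-matching. Fewer edges outside `A` would make it
larger than `O`; equality would make it a maximum one with a larger overlap with `A`. -/
theorem IsClosedUnder.card_filter_lt (hA : IsTriangleFreeTwoMatching G A)
    (hO : IsMaximumTriangleFreeTwoMatching G O)
    (hinter : ∀ M, IsMaximumTriangleFreeTwoMatching G M → #(M ∩ A) ≤ #(O ∩ A))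
    (hex : IsExchangeFree (EdgeRel A) (EdgeRel O)) (hπ : IsPairing (EdgeRel A) (EdgeRel O) π)
    (hK : IsClosedUnder π K) (hKD : K ⊆ A ∆ O) (hne : K.Nonempty) :
    #{e ∈ K | e ∈ A} < #{e ∈ K | e ∉ A} := by
  have hM := IsClosedUnder.isTriangleFreeTwoMatching_symmDiff (K := K) hO.1 hA (hπ.swap hex)
    (fun x y z h => (hK x z y h).symm) (by rwa [symmDiff_comm])
  have hA_iff (e : Sym2 V) (he : e ∈ K) : e ∈ O ↔ e ∉ A := by
    have := hKD he
    rw [mem_symmDiff] at this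
    tauto
  have hcard := card_symmDiff_add_card_filter O K
  rw [filter_congr hA_iff, filter_congr (fun e he => not_congr (hA_iff e he))] at hcard
  simp only [not_not] at hcard
  have hle := hO.2 _ hM
  by_contra hcon
  have heq : #(O ∆ K) = #O := by omega
  have hle' := hinter _ ⟨hM, fun M' hM' => heq ▸ hO.2 M' hM'⟩
  -- A nonempty `K` without edges of `A` would satisfy the strict inequality outright.
  have hK' : ∃ e ∈ K, e ∈ A := by
    by_contra hno
    push Not at hno
    have h1 : #{e ∈ K | e ∈ A} = 0 := by
      rw [card_eq_zero, filter_eq_empty_iff]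
      exact fun e he => hno e he
    have h2 : #{e ∈ K | e ∉ A} = #K := by rw [filter_true_of_mem hno]
    have := hne.card_pos
    omega
  obtain ⟨e, he, heA⟩ := hK'
  refine absurd hle' (not_le.2 (card_lt_card ((ssubset_iff_of_subset ?_).2 ⟨e, ?_, ?_⟩)))
  · intro f
    have := hA_iff f
    simp only [mem_inter, mem_symmDiff]
    tauto
  · have := hA_iff e he
    simp only [mem_inter, mem_symmDiff]
    tauto
  · have := hA_iff e he
    simp only [mem_inter]
    tauto

theorem card_filter_mk_mem [Fintype V] {M : Finset (Sym2 V)} (hM : ∀ x, s(x, x) ∉ M) :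
    #{d : V × V | s(d.1, d.2) ∈ M} = 2 * #M := by
  rw [card_eq_sum_card_fiberwise (f := fun d : V × V => s(d.1, d.2)) (t := M)
    (fun d hd => by simpa using hd), sum_const_nat (m := 2), mul_comm]
  intro e
  induction e with
  | _ x y =>
    intro he
    have hxy : x ≠ y := by
      rintro rfl
      exact hM x he
    have : ({a ∈ ({d : V × V | s(d.1, d.2) ∈ M} : Finset (V × V)) | s(a.1, a.2) = s(x, y)}) =
        {(x, y), (y, x)} := by
      ext ⟨p, q⟩
      simp only [mem_filter, mem_univ, true_and, mem_insert, mem_singleton, Prod.mk.injEq,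
        Sym2.eq_iff]
      constructor
      · exact fun h => h.2
      · rintro (⟨rfl, rfl⟩ | ⟨rfl, rfl⟩)
        · exact ⟨he, Or.inl ⟨rfl, rfl⟩⟩
        · exact ⟨Sym2.eq_swap ▸ he, Or.inr ⟨rfl, rfl⟩⟩
    rw [this, card_pair (by simp [hxy])]

/-- Every edge has two ends. If all ends of edges outside `A` were paired, the pairing would inject
them into the fewer ends of edges of `A` in `K`. -/
theorem IsClosedUnder.exists_unpaired [Fintype V] (hπ : IsPairing (EdgeRel A) (EdgeRel O) π)
    (hK : IsClosedUnder π K) (hloop : ∀ x, s(x, x) ∉ K)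
    (hcard : #{e ∈ K | e ∈ A} < #{e ∈ K | e ∉ A}) :
    ∃ x y, s(x, y) ∈ K ∧ s(x, y) ∉ A ∧ ∀ z, ¬ π x y z := by
  by_contra! hcon
  choose! g hg using hcon
  have h1 := card_filter_mk_mem (M := {e ∈ K | e ∈ A}) (fun x hx => hloop x (mem_filter.1 hx).1)
  have h2 := card_filter_mk_mem (M := {e ∈ K | e ∉ A}) (fun x hx => hloop x (mem_filter.1 hx).1)
  have h3 : #{d : V × V | s(d.1, d.2) ∈ ({e ∈ K | e ∉ A} : Finset _)} ≤
      #{d : V × V | s(d.1, d.2) ∈ ({e ∈ K | e ∈ A} : Finset _)} := by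
    refine card_le_card_of_injOn (fun d => (d.1, g d.1 d.2)) ?_ ?_
    · rintro ⟨x, y⟩ h
      simp only [coe_filter, mem_filter, mem_univ, true_and, Set.mem_ofPred_eq] at h ⊢
      have := hg x y h.1 h.2
      exact ⟨(hK _ _ _ this).1 h.1, (hπ.right _ _ _ this).1⟩
    · rintro ⟨x, y⟩ h ⟨x', y'⟩ h' heq
      simp only [coe_filter, mem_filter, mem_univ, true_and, Set.mem_ofPred_eq,
        Prod.mk.injEq] at h h' heq ⊢
      obtain ⟨rfl, heq⟩ := heq
      exact ⟨rfl, hπ.left_unique _ _ _ _ (hg x y h.1 h.2) (heq ▸ hg x y' h'.1 h'.2)⟩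
  omega

/-- A trail whose edge set is closed except possibly at its first edge `uw` and node `u`
can be extended to a trail with a closed edge set. -/
theorem exists_closed_trail (hπ : IsPairing (EdgeRel A) (EdgeRel O) π)
    (hK : IsClosedUnder π K) (hKG : ∀ x y, s(x, y) ∈ K → G.Adj x y) (n : ℕ) {u w v : V}
    (h : G.Adj u w) (Q : G.Walk w v) (hn : #K < Q.length + 1 + n)
    (hP : IsAlternatingTrail A (SimpleGraph.Walk.cons h Q))
    (hPK : ∀ e ∈ (SimpleGraph.Walk.cons h Q).edges, e ∈ K)
    (hinv : ∀ x y z, π x y z ∨ π x z y → s(x, y) ∈ (SimpleGraph.Walk.cons h Q).edges →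
      s(x, z) ∈ (SimpleGraph.Walk.cons h Q).edges ∨ x = u ∧ y = w) :
    ∃ (u' : V) (P : G.Walk u' v), IsAlternatingTrail A P ∧ P.edges ≠ [] ∧
      (∀ e ∈ P.edges, e ∈ K) ∧ IsClosedUnder π P.edges.toFinset := by
  have partner_unique (x y z z' : V) (h1 : π x y z ∨ π x z y) (h2 : π x y z' ∨ π x z' y) :
      z = z' := by
    rcases h1 with h1 | h1 <;> rcases h2 with h2 | h2
    · exact hπ.right_unique _ _ _ _ h1 h2
    · exact ((hπ.left _ _ _ h1).2 (hπ.right _ _ _ h2).1).elim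
    · exact ((hπ.left _ _ _ h2).2 (hπ.right _ _ _ h1).1).elim
    · exact hπ.left_unique _ _ _ _ h1 h2
  -- `n` bounds the number of further extensions: a trail in `K` has at most `#K` edges.
  induction n generalizing u w with
  | zero =>
    have h1 : #(SimpleGraph.Walk.cons h Q).edges.toFinset ≤ #K :=
      card_le_card fun e he => hPK e (List.mem_toFinset.1 he)
    rw [List.toFinset_card_of_nodup hP.1.edges_nodup, SimpleGraph.Walk.length_edges,
      SimpleGraph.Walk.length_cons] at h1
    omega
  | succ n ih =>
    by_cases hclosed : IsClosedUnder π (SimpleGraph.Walk.cons h Q).edges.toFinset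
    · exact ⟨u, _, hP, by simp, hPK, hclosed⟩
    have hopen : ∃ x y z, (π x y z ∨ π x z y) ∧
        s(x, y) ∈ (SimpleGraph.Walk.cons h Q).edges ∧
        s(x, z) ∉ (SimpleGraph.Walk.cons h Q).edges := by
      by_contra! hno
      refine hclosed fun x y z hxyz => ?_
      rw [List.mem_toFinset, List.mem_toFinset]
      exact ⟨hno x y z (Or.inl hxyz), hno x z y (Or.inr hxyz)⟩
    obtain ⟨x, y, z, hxyz, hy, hz⟩ := hopen
    -- A missing partner can only belong to the first edge at the first node, so prepending it
    -- continues the trail.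
    obtain ⟨rfl, rfl⟩ := (hinv x y z hxyz hy).resolve_left hz
    have hzK : s(x, z) ∈ K := by
      rcases hxyz with h' | h'
      · exact (hK _ _ _ h').1 (hPK _ hy)
      · exact (hK _ _ _ h').2 (hPK _ hy)
    have hzx : s(z, x) = s(x, z) := Sym2.eq_swap
    have halt : ¬ (s(x, z) ∈ A ↔ s(x, y) ∈ A) := by
      rcases hxyz with h' | h' <;> have h1 := hπ.left _ _ _ h' <;> have h2 := hπ.right _ _ _ h' <;>
        simp only [OnlyFirst, EdgeRel] at h1 h2 <;> tauto
    refine ih (hKG x z hzK).symm (SimpleGraph.Walk.cons h Q) ?_ ⟨?_, ?_⟩ ?_ ?_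
    · rw [SimpleGraph.Walk.length_cons]
      omega
    · rw [SimpleGraph.Walk.isTrail_cons, hzx]
      exact ⟨hP.1, hz⟩
    · have := hP.2
      rw [SimpleGraph.Walk.edges_cons] at this
      rw [SimpleGraph.Walk.edges_cons, SimpleGraph.Walk.edges_cons, List.isChain_cons_cons, hzx]
      exact ⟨halt, this⟩
    · intro e he
      rw [SimpleGraph.Walk.edges_cons, List.mem_cons] at he
      rcases he with rfl | he
      · rwa [hzx]
      · exact hPK e he
    · intro x' y' z' hpair hy'
      rw [SimpleGraph.Walk.edges_cons, List.mem_cons] at hy' ⊢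
      rcases hy' with hy' | hy'
      · rcases Sym2.eq_iff.1 hy' with ⟨rfl, rfl⟩ | ⟨rfl, rfl⟩
        · exact Or.inr ⟨rfl, rfl⟩
        · have := partner_unique _ _ _ _ hpair hxyz.symm
          subst this
          exact Or.inl (Or.inr hy)
      · rcases hinv x' y' z' hpair hy' with h' | ⟨rfl, rfl⟩
        · exact Or.inl (Or.inr h')
        · rw [partner_unique _ _ _ _ hpair hxyz]
          exact Or.inl (Or.inl Sym2.eq_swap)

theorem countP_notMem_le {α : Type*} [DecidableEq α] {M : Finset α} {l : List α}
    (hl : l.IsChain (fun e f => ¬ (e ∈ M ↔ f ∈ M))) :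
    l.countP (· ∉ M) ≤ l.countP (· ∈ M) + 1 := by
  -- The induction needs the sharper bound that a list starting in `M` has no excess.
  suffices H : ∀ (l : List α) (a : α), (a :: l).IsChain (fun e f => ¬ (e ∈ M ↔ f ∈ M)) →
      (a :: l).countP (· ∉ M) ≤ (a :: l).countP (· ∈ M) + if a ∈ M then 0 else 1 by
    cases l with
    | nil => simp
    | cons a l =>
      have := H l a hl
      split_ifs at this <;> omega
  intro l
  induction l with
  | nil => intro a _; by_cases ha : a ∈ M <;> simp [ha]
  | cons b l ih =>
    intro a h
    rw [List.isChain_cons_cons] at h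
    have := ih b h.2
    have h1 := h.1
    rw [List.countP_cons, List.countP_cons (l := b :: l)]
    by_cases ha : a ∈ M <;> by_cases hb : b ∈ M <;> simp_all

theorem IsAlternatingTrail.card_filter_le {u v : V} {P : G.Walk u v}
    (hP : IsAlternatingTrail A P) :
    #{e ∈ P.edges.toFinset | e ∉ A} ≤ #{e ∈ P.edges.toFinset | e ∈ A} + 1 := by
  have h := countP_notMem_le hP.2
  rw [List.countP_eq_length_filter, List.countP_eq_length_filter,
    ← List.toFinset_card_of_nodup (hP.1.edges_nodup.filter _),
    ← List.toFinset_card_of_nodup (hP.1.edges_nodup.filter _), List.toFinset_filter,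
    List.toFinset_filter] at h
  simpa using h

/-- Every closed set of edges contains as many disjoint augmenting trails as it has more edges
outside `A` than in `A`. -/
theorem IsClosedUnder.exists_disjoint_augmentingTrails [Fintype V]
    (hA : IsTriangleFreeTwoMatching G A) (hO : IsMaximumTriangleFreeTwoMatching G O)
    (hinter : ∀ M, IsMaximumTriangleFreeTwoMatching G M → #(M ∩ A) ≤ #(O ∩ A))
    (hex : IsExchangeFree (EdgeRel A) (EdgeRel O)) (hπ : IsPairing (EdgeRel A) (EdgeRel O) π)
    (hK : IsClosedUnder π K) (hKD : K ⊆ A ∆ O) :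
    ∃ (k : ℕ) (T : Fin k → Σ u v, G.Walk u v), #{e ∈ K | e ∉ A} ≤ #{e ∈ K | e ∈ A} + k ∧
      (∀ i, IsAugmentingTrail A (T i).2.2) ∧ (∀ i, (T i).2.2.edges.toFinset ⊆ K) ∧
      ∀ i j, i ≠ j → Disjoint (T i).2.2.edges.toFinset (T j).2.2.edges.toFinset := by
  induction K using Finset.strongInduction with
  | H K ih =>
  rcases K.eq_empty_or_nonempty with rfl | hne
  · exact ⟨0, Fin.elim0, by simp, fun i => i.elim0, fun i => i.elim0, fun i => i.elim0⟩
  have hKG (x y : V) (h : s(x, y) ∈ K) : G.Adj x y := by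
    have h1 := (isTriangleFreeTwoMatching_iff.1 hA).1 x y
    have h2 := (isTriangleFreeTwoMatching_iff.1 hO.1).1 x y
    have := hKD h
    rw [mem_symmDiff] at this
    tauto
  obtain ⟨y, x, hyx, hyxA, hfree⟩ := hK.exists_unpaired hπ (fun x h => (hKG x x h).ne rfl)
    (hK.card_filter_lt hA hO hinter hex hπ hKD hne)
  -- The trail grows at its front from the single edge `xy`; its last node is the unpaired end `y`,
  -- where no extension is required.
  obtain ⟨u, P, hP, hPne, hPK, hPclosed⟩ := exists_closed_trail hπ hK hKG #K (hKG y x hyx).symm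
    SimpleGraph.Walk.nil (by simp) ⟨by simp, by simp⟩
    (by simpa [Sym2.eq_swap] using hyx) (by
      intro p q r hpair hpq
      right
      simp only [SimpleGraph.Walk.edges_cons, SimpleGraph.Walk.edges_nil,
        List.mem_singleton] at hpq
      rcases Sym2.eq_iff.1 hpq with h | ⟨rfl, rfl⟩
      · exact h
      · rcases hpair with h | h
        · exact (hfree _ h).elim
        · exact (hyxA (hπ.right _ _ _ h).1).elim)
  set L := P.edges.toFinset with hL
  have hLK : L ⊆ K := fun e he => hPK e (List.mem_toFinset.1 he)
  have hLne : L.Nonempty := List.toFinset_nonempty_iff _ |>.2 hPne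
  have hlt := hPclosed.card_filter_lt hA hO hinter hex hπ (hLK.trans hKD) hLne
  have hle := hP.card_filter_le
  rw [← hL] at hle
  -- Closedness gives excess at least one (`hlt`), alternation at most one (`hle`).
  have haug : IsAugmentingTrail A P := by
    refine ⟨hP, hPclosed.isTriangleFreeTwoMatching_symmDiff hA hO.1 hπ (hLK.trans hKD), ?_⟩
    have := card_symmDiff_add_card_filter A L
    rw [← hL]
    omega
  obtain ⟨k, T, hk, hT, hTK, hTd⟩ := ih (K \ L) (sdiff_ssubset hLK hLne) (hK.sdiff hPclosed)
    (sdiff_subset.trans hKD)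
  have hdisj (i : Fin k) : Disjoint L (T i).2.2.edges.toFinset :=
    disjoint_sdiff.mono_right (hTK i)
  have hsplit (p : Sym2 V → Prop) [DecidablePred p] :
      #{e ∈ K | p e} = #{e ∈ K \ L | p e} + #{e ∈ L | p e} := by
    rw [← card_union_of_disjoint (disjoint_filter_filter sdiff_disjoint), ← filter_union,
      sdiff_union_of_subset hLK]
  refine ⟨k + 1, Fin.cons ⟨u, y, P⟩ T, ?_, ?_, ?_, ?_⟩
  · rw [hsplit, hsplit]
    omega
  · exact Fin.cases haug hT
  · exact Fin.cases hLK fun i => (hTK i).trans sdiff_subset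
  · intro i j
    induction i using Fin.cases with
    | zero =>
      induction j using Fin.cases with
      | zero => exact fun h => (h rfl).elim
      | succ j => exact fun _ => hdisj j
    | succ i =>
      induction j using Fin.cases with
      | zero => exact fun _ => (hdisj i).symm
      | succ j => exact fun h => hTd i j fun hij => h (hij ▸ rfl)

end Closed

theorem lemma2 {V : Type*} [Fintype V] [DecidableEq V] (G : SimpleGraph V)
    (APX OPT : Finset (Sym2 V))
    (hAPX : IsTriangleFreeTwoMatching G APX)
    (hOPT : IsMaximumTriangleFreeTwoMatching G OPT)
    (hinter : ∀ M, IsMaximumTriangleFreeTwoMatching G M → #(M ∩ APX) ≤ #(OPT ∩ APX)) :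
    ∃ (k : ℕ) (a b : Fin k → V) (P : (i : Fin k) → G.Walk (a i) (b i)),
      #OPT ≤ #APX + k ∧
      (∀ i, IsAugmentingTrail APX (P i)) ∧
      (∀ i, (P i).edges.toFinset ⊆ APX ∆ OPT) ∧
      (∀ i j, i ≠ j → Disjoint (P i).edges.toFinset (P j).edges.toFinset) := by
  have hex := isExchangeFree_edgeRel hAPX hOPT hinter
  obtain ⟨π, hπ⟩ := hex.exists_isPairing
  have hclosed : IsClosedUnder π (APX ∆ OPT) := by
    intro x y z h
    have h1 := hπ.left _ _ _ h
    have h2 := hπ.right _ _ _ h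
    simp only [OnlyFirst, EdgeRel] at h1 h2
    simp only [mem_symmDiff]
    tauto
  obtain ⟨k, T, hk, hT, hTK, hTd⟩ := hclosed.exists_disjoint_augmentingTrails hAPX hOPT hinter hex
    hπ Subset.rfl
  refine ⟨k, fun i => (T i).1, fun i => (T i).2.1, fun i => (T i).2.2, ?_, hT, hTK, hTd⟩
  -- The excess of the whole symmetric difference is the difference of the cardinalities of `OPT`
  -- and `APX`.
  have := card_symmDiff_add_card_filter APX (APX ∆ OPT)
  rw [symmDiff_symmDiff_cancel_left] at this
  omega
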